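/- Let $Y\ge 0$ be a random variable with all moments finite, $m_k=\mathbf E[Y^k]<\infty$ for $k=1,2,\dots$, whose distribution $G$ is absolutely continuous with density $g$. Suppose that, for some $a>1$, $g$ is continuous and strictly positive on $[a,\infty)$, that $$\int_a^\infty \frac{-\ln g(x^2)}{x^2\ln x}\,dx=\infty,$$ and that the function $x\mapsto \dfrac{-\ln g(x)}{\ln x}$ is monotone increasing (in the weak sense) on $[a,\infty)$ and tends to $\infty$ as $x\to\infty$. Then $Y$ satisfies Carleman's condition in the Stieltjes case, $$\sum_{k=1}^\infty m_k^{-1/(2k)}=\infty,$$ and $Y$ is moment-determinate on $[0,\infty)$: $G$ is the only probability distribution on $[0,\infty)$ with moment sequence $(m_k)_{k\ge1}$. -/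

import Mathlib

open MeasureTheory ProbabilityTheory Filter Set
open scoped ENNReal

/-- All moments of the distribution `μ` on the real line are finite. -/
def HasFiniteMoments (μ : Measure ℝ) : Prop :=
  ∀ k : ℕ, Integrable (fun x : ℝ => |x| ^ k) μ

/-- Carleman's condition in the Stieltjes case: all moments `m_k` are finite and
`∑_{k ≥ 1} m_k ^ (-1 / (2 k)) = ∞`. The sum is taken in `[0, ∞]`, where `0 ^ (-1 / (2 k)) = ∞`;
the summation index `k` below stands for the moment of order `k + 1`. -/
def StieltjesCarleman (μ : Measure ℝ) : Prop :=
  HasFiniteMoments μ ∧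
    ∑' k : ℕ, ENNReal.ofReal (moment id (k + 1) μ) ^ (-(1 / (2 * ((k : ℝ) + 1)))) = ∞

/-- Moment-determinacy in the Stieltjes case: `μ` is a distribution on `[0, ∞)` with finite
moments, and it is the only probability distribution on `[0, ∞)` with its moments. -/
def StieltjesMDeterminate (μ : Measure ℝ) : Prop :=
  IsProbabilityMeasure μ ∧ μ (Iio 0) = 0 ∧ HasFiniteMoments μ ∧
    ∀ ν : Measure ℝ, IsProbabilityMeasure ν → ν (Iio 0) = 0 → HasFiniteMoments ν →
      (∀ k : ℕ, 1 ≤ k → moment id k ν = moment id k μ) → ν = μ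

/-! Two laws on `[0, ∞)` with the same moments give symmetrised square roots `± √X` with the same
moments, so the difference of their characteristic functions is flat at `0`. Carleman's condition
bounds its derivatives by a log-convex sequence `M` with `∑ M n ^ (-1 / n) = ∞`; Bang's proof of
the Denjoy–Carleman theorem then shows that the difference vanishes.

Write the density as `x ^ (-u x)` with `u` increasing, and let `c k` be the point at which `u`
passes the level `k + 3`. Beyond `c k` the integrand of the moment of order `k + 1` is at most
`x ^ (-2)`, so this moment is at most `(2 * c k) ^ (k + 1)`. Counting the levels below `u (x ^ 2)`
gives `u (x ^ 2) ≤ 3 + #{k | √(c k) ≤ x}`, and integrating this against `x ^ (-2)` turns the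
divergence of the integral into `∑ 1 / √(c k) = ∞`, which is Carleman's condition. -/

section CarlemanInequality

lemma succ_pow_le_exp_mul_factorial (n : ℕ) : ((n : ℝ) + 1) ^ n ≤ Real.exp n * n.factorial := by
  induction n with
  | zero => simp
  | succ n ih =>
    have hn : ((n : ℝ) + 1) ≠ 0 := by positivity
    have hexp : (1 + ((n + 1 : ℕ) : ℝ)⁻¹) ^ (n + 1) ≤ Real.exp 1 := Real.one_add_inv_pow_le_exp
    calc ((n + 1 : ℕ) + 1 : ℝ) ^ (n + 1)
        = (1 + ((n + 1 : ℕ) : ℝ)⁻¹) ^ (n + 1) * (((n : ℝ) + 1) ^ n * (n + 1)) := by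
          rw [← pow_succ, ← mul_pow]
          congr 1
          push_cast
          field_simp
      _ ≤ Real.exp 1 * (Real.exp n * n.factorial * (n + 1)) := by gcongr
      _ = Real.exp (n + 1 : ℕ) * (n + 1).factorial := by
          rw [Nat.factorial_succ, Nat.cast_succ, Real.exp_add]
          push_cast
          ring

/- The weights `i + 1` in the arithmetic-geometric mean inequality make the right-hand sides
telescope when summed over `n`. -/
lemma geom_mean_le_weighted_sum {a : ℕ → ℝ} (ha : ∀ i, 0 ≤ a i) (n : ℕ) :
    (∏ i ∈ Finset.range (n + 1), a i) ^ (1 / ((n : ℝ) + 1)) ≤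
      Real.exp 1 * (1 / ((n : ℝ) + 1) - 1 / ((n : ℝ) + 2)) *
        ∑ i ∈ Finset.range (n + 1), ((i : ℝ) + 1) * a i := by
  set S := ∑ i ∈ Finset.range (n + 1), ((i : ℝ) + 1) * a i
  set G := (∏ i ∈ Finset.range (n + 1), a i) ^ (1 / ((n : ℝ) + 1))
  have hG : 0 ≤ G := Real.rpow_nonneg (Finset.prod_nonneg fun i _ => ha i) _
  have hprod : ∏ i ∈ Finset.range (n + 1), ((i : ℝ) + 1) * a i =
      (n + 1).factorial * ∏ i ∈ Finset.range (n + 1), a i := by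
    rw [Finset.prod_mul_distrib, ← Finset.prod_range_add_one_eq_factorial]
    push_cast
    rfl
  have hmean : ((n + 1).factorial : ℝ) ^ (1 / ((n : ℝ) + 1)) * G ≤ S / (n + 1) := by
    have h := Real.geom_mean_le_arith_mean (Finset.range (n + 1)) (fun _ => 1)
      (fun i => ((i : ℝ) + 1) * a i) (fun _ _ => zero_le_one)
      (Finset.sum_pos (fun _ _ => one_pos) Finset.nonempty_range_add_one)
      (fun i _ => mul_nonneg (by positivity) (ha i))
    simpa [hprod, Real.mul_rpow, Finset.prod_nonneg, ha, S, G] using h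
  have hfactorial : ((n : ℝ) + 2) / Real.exp 1 ≤
      ((n + 1).factorial : ℝ) ^ (1 / ((n : ℝ) + 1)) := by
    have hn : (n : ℝ) + 2 = (n + 1 : ℕ) + 1 := by push_cast; ring
    rw [one_div, Real.le_rpow_inv_iff_of_pos (by positivity) (by positivity) (by positivity),
      ← Nat.cast_succ, Real.rpow_natCast, div_pow, div_le_iff₀' (by positivity),
      ← Real.exp_nat_mul, mul_one, hn]
    exact succ_pow_le_exp_mul_factorial (n + 1)
  calc G = Real.exp 1 / (n + 2) * ((n + 2) / Real.exp 1 * G) := by field_simp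
    _ ≤ Real.exp 1 / (n + 2) * (S / (n + 1)) := by
        gcongr
        exact (mul_le_mul_of_nonneg_right hfactorial hG).trans hmean
    _ = _ := by field_simp; ring

theorem sum_geom_mean_le {a : ℕ → ℝ} (ha : ∀ i, 0 ≤ a i) (N : ℕ) :
    ∑ n ∈ Finset.range N, (∏ i ∈ Finset.range (n + 1), a i) ^ (1 / ((n : ℝ) + 1)) ≤
      Real.exp 1 * ∑ i ∈ Finset.range N, a i := by
  suffices h : ∑ n ∈ Finset.range N, (∏ i ∈ Finset.range (n + 1), a i) ^ (1 / ((n : ℝ) + 1)) ≤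
      Real.exp 1 * (∑ i ∈ Finset.range N, a i -
        1 / ((N : ℝ) + 1) * ∑ i ∈ Finset.range N, ((i : ℝ) + 1) * a i) by
    refine h.trans (mul_le_mul_of_nonneg_left (sub_le_self _ ?_) (Real.exp_pos 1).le)
    exact mul_nonneg (by positivity)
      (Finset.sum_nonneg fun i _ => mul_nonneg (by positivity) (ha i))
  induction N with
  | zero => simp
  | succ N ih =>
    rw [Finset.sum_range_succ]
    refine (add_le_add ih (geom_mean_le_weighted_sum ha N)).trans_eq ?_
    rw [Finset.sum_range_succ, Finset.sum_range_succ]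
    push_cast
    field_simp
    ring

theorem summable_geom_mean {a : ℕ → ℝ} (ha : ∀ i, 0 ≤ a i) (hsum : Summable a) :
    Summable fun n : ℕ => (∏ i ∈ Finset.range (n + 1), a i) ^ (1 / ((n : ℝ) + 1)) :=
  summable_of_sum_range_le (fun _ => Real.rpow_nonneg (Finset.prod_nonneg fun i _ => ha i) _)
    fun N => (sum_geom_mean_le ha N).trans
      (mul_le_mul_of_nonneg_left (hsum.sum_le_tsum _ fun i _ => ha i) (Real.exp_pos 1).le)

end CarlemanInequality

section DenjoyCarleman

variable {E : Type*} [NormedAddCommGroup E] [NormedSpace ℝ E] {F : ℕ → ℝ → E} {r : ℕ → ℝ} {C : ℝ}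

lemma norm_le_mul_exp_of_hasDerivAt (hF : ∀ n t, HasDerivAt (F n) (F (n + 1) t) t)
    {w : ℕ → ℝ} (hw : ∀ n, 0 ≤ w n) {K s : ℝ} (hK : 0 ≤ K) {N : ℕ}
    (hstep : ∀ n < N, w (n + 1) ≤ K * w n) (hs : ∀ n < N, ‖F n s‖ ≤ w n)
    (htop : ∀ t, ‖F N t‖ ≤ w N) {n : ℕ} (hn : n ≤ N) {x : ℝ} (hx : s ≤ x) :
    ‖F n x‖ ≤ w n * Real.exp (K * (x - s)) := by
  induction hn using Nat.decreasingInduction generalizing x with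
  | self =>
    exact (htop x).trans (le_mul_of_one_le_right (hw N)
      (Real.one_le_exp (mul_nonneg hK (sub_nonneg.2 hx))))
  | of_succ n hn ih =>
    have hbarrier : ∀ y, HasDerivAt (fun y => w n * Real.exp (K * (y - s)))
        (w n * (Real.exp (K * (y - s)) * (K * 1))) y := fun y =>
      ((((hasDerivAt_id y).sub_const s).const_mul K).exp).const_mul (w n)
    refine image_norm_le_of_norm_deriv_right_le_deriv_boundary (a := s) (b := x)
      (fun y _ => (hF n y).continuousAt.continuousWithinAt)
      (fun y _ => (hF n y).hasDerivWithinAt) (by simpa using hs n hn) hbarrier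
      (fun y hy => ?_) (right_mem_Icc.2 hx)
    calc ‖F (n + 1) y‖ ≤ w (n + 1) * Real.exp (K * (y - s)) := ih hy.1
      _ ≤ K * w n * Real.exp (K * (y - s)) := by gcongr; exact hstep n hn
      _ = w n * (Real.exp (K * (y - s)) * (K * 1)) := by ring

/- Bang's argument: a step of length `(e * r k)⁻¹` costs a factor of at most `e`. The chain of
derivatives is cut at order `k + 1`, beyond which `hbound` is already strong enough. -/
lemma norm_le_exp_sub_of_norm_le_exp_sub_succ (hF : ∀ n t, HasDerivAt (F n) (F (n + 1) t) t)
    (hr : ∀ n, 0 < r n) (hmono : Monotone r)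
    (hbound : ∀ n t, ‖F n t‖ ≤ C * ∏ i ∈ Finset.range n, r i) {k : ℕ} {s x : ℝ}
    (hs : ∀ n : ℕ, ‖F n s‖ ≤ C * Real.exp (n - (k + 1)) * ∏ i ∈ Finset.range n, r i)
    (hsx : s ≤ x) (hx : x ≤ s + (Real.exp 1 * r k)⁻¹) (n : ℕ) :
    ‖F n x‖ ≤ C * Real.exp (n - k) * ∏ i ∈ Finset.range n, r i := by
  have hC : 0 ≤ C := by simpa using (norm_nonneg _).trans (hbound 0 0)
  have hP : ∀ n, 0 ≤ ∏ i ∈ Finset.range n, r i := fun n => Finset.prod_nonneg fun i _ => (hr i).le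
  rcases le_or_gt n (k + 1) with hn | hn
  · have hK : 0 < Real.exp 1 * r k := mul_pos (Real.exp_pos 1) (hr k)
    have hgrow : ‖F n x‖ ≤ C * Real.exp (n - (k + 1)) * (∏ i ∈ Finset.range n, r i) *
        Real.exp (Real.exp 1 * r k * (x - s)) := by
      refine norm_le_mul_exp_of_hasDerivAt hF (fun n => mul_nonneg (by positivity) (hP n)) hK.le
        (fun m hm => ?_) (fun m _ => hs m) (fun t => ?_) hn hsx
      · have hrm : r m ≤ r k := hmono (Nat.lt_succ_iff.1 hm)
        calc C * Real.exp ((m + 1 : ℕ) - (k + 1)) * ∏ i ∈ Finset.range (m + 1), r i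
            = Real.exp 1 * r m * (C * Real.exp (m - (k + 1)) * ∏ i ∈ Finset.range m, r i) := by
              rw [Finset.prod_range_succ, Nat.cast_succ, add_sub_right_comm, Real.exp_add]
              ring
          _ ≤ _ := by
              gcongr
              exact mul_nonneg (by positivity) (hP m)
      · simpa using hbound (k + 1) t
    have hexp : Real.exp (Real.exp 1 * r k * (x - s)) ≤ Real.exp 1 := by
      rw [Real.exp_le_exp, ← le_div_iff₀' hK, one_div]
      linarith
    calc ‖F n x‖ ≤ C * Real.exp (n - (k + 1)) * (∏ i ∈ Finset.range n, r i) * Real.exp 1 :=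
          hgrow.trans (mul_le_mul_of_nonneg_left hexp (mul_nonneg (by positivity) (hP n)))
      _ = C * (Real.exp (n - (k + 1)) * Real.exp 1) * ∏ i ∈ Finset.range n, r i := by ring
      _ = C * Real.exp (n - k) * ∏ i ∈ Finset.range n, r i := by
          rw [← Real.exp_add]
          ring_nf
  · have hkn : (k : ℝ) ≤ n := by exact_mod_cast (Nat.lt_of_succ_lt hn).le
    exact (hbound n x).trans (mul_le_mul_of_nonneg_right
      (le_mul_of_one_le_right hC (Real.one_le_exp (sub_nonneg.2 hkn))) (hP n))

lemma norm_le_exp_sub_of_le_sum (hF : ∀ n t, HasDerivAt (F n) (F (n + 1) t) t)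
    (hr : ∀ n, 0 < r n) (hmono : Monotone r) (h0 : ∀ n, F n 0 = 0)
    (hbound : ∀ n t, ‖F n t‖ ≤ C * ∏ i ∈ Finset.range n, r i) {d k : ℕ} {x : ℝ} (hx0 : 0 ≤ x)
    (hx : x ≤ ∑ i ∈ Finset.range d, (Real.exp 1 * r (i + k))⁻¹) (n : ℕ) :
    ‖F n x‖ ≤ C * Real.exp (n - k) * ∏ i ∈ Finset.range n, r i := by
  induction d generalizing k x n with
  | zero =>
    have hC : 0 ≤ C := by simpa using (norm_nonneg _).trans (hbound 0 0)
    obtain rfl : x = 0 := le_antisymm (by simpa using hx) hx0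
    rw [h0, norm_zero]
    exact mul_nonneg (by positivity) (Finset.prod_nonneg fun i _ => (hr i).le)
  | succ d ih =>
    have hpos : ∀ i, 0 < (Real.exp 1 * r i)⁻¹ := fun i =>
      inv_pos.2 (mul_pos (Real.exp_pos 1) (hr i))
    set T := ∑ i ∈ Finset.range d, (Real.exp 1 * r (i + (k + 1)))⁻¹
    have hT : 0 ≤ T := Finset.sum_nonneg fun i _ => (hpos _).le
    have hxT : x ≤ T + (Real.exp 1 * r k)⁻¹ := by
      simpa [T, Finset.sum_range_succ', add_right_comm, add_assoc] using hx
    refine norm_le_exp_sub_of_norm_le_exp_sub_succ (s := min x T) hF hr hmono hbound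
      (fun m => ?_) (min_le_left _ _) ?_ n
    · simpa using ih (k := k + 1) (le_min hx0 hT) (min_le_right _ _) m
    · rw [min_add, le_min_iff]
      exact ⟨le_add_of_nonneg_right (hpos k).le, hxT⟩

lemma eq_zero_of_flat_of_nonneg (hF : ∀ n t, HasDerivAt (F n) (F (n + 1) t) t)
    (hr : ∀ n, 0 < r n) (hmono : Monotone r) (hdiv : ¬ Summable fun n => (r n)⁻¹)
    (h0 : ∀ n, F n 0 = 0) (hbound : ∀ n t, ‖F n t‖ ≤ C * ∏ i ∈ Finset.range n, r i)
    {x : ℝ} (hx : 0 ≤ x) : F 0 x = 0 := by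
  have hdecay : ∀ k : ℕ, ‖F 0 x‖ ≤ C * Real.exp (-k) := fun k => by
    have hdiv' : ¬ Summable fun i => (Real.exp 1 * r (i + k))⁻¹ := by
      simp_rw [mul_inv]
      rwa [summable_mul_left_iff (inv_ne_zero (Real.exp_pos 1).ne'),
        summable_nat_add_iff (f := fun i => (r i)⁻¹)]
    have hsum := (not_summable_iff_tendsto_nat_atTop_of_nonneg
      fun i => inv_nonneg.2 (mul_pos (Real.exp_pos 1) (hr (i + k))).le).1 hdiv'
    obtain ⟨d, hd⟩ := (hsum.eventually_ge_atTop x).exists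
    simpa using norm_le_exp_sub_of_le_sum hF hr hmono h0 hbound hx hd 0
  have hlim : Tendsto (fun k : ℕ => C * Real.exp (-k)) atTop (nhds (C * 0)) :=
    (Real.tendsto_exp_neg_atTop_nhds_zero.comp tendsto_natCast_atTop_atTop).const_mul C
  rw [mul_zero] at hlim
  exact norm_le_zero_iff.1 (ge_of_tendsto' hlim hdecay)

theorem eq_zero_of_flat_of_norm_le_prod (hF : ∀ n t, HasDerivAt (F n) (F (n + 1) t) t)
    (hr : ∀ n, 0 < r n) (hmono : Monotone r) (hdiv : ¬ Summable fun n => (r n)⁻¹)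
    (h0 : ∀ n, F n 0 = 0) (hbound : ∀ n t, ‖F n t‖ ≤ C * ∏ i ∈ Finset.range n, r i) (x : ℝ) :
    F 0 x = 0 := by
  rcases le_total 0 x with hx | hx
  · exact eq_zero_of_flat_of_nonneg hF hr hmono hdiv h0 hbound hx
  · have hreflect : ∀ n t, HasDerivAt (fun t => (-1 : ℝ) ^ n • F n (-t))
        ((-1 : ℝ) ^ (n + 1) • F (n + 1) (-t)) t := fun n t => by
      simpa [pow_succ, mul_smul, Function.comp_def] using
        ((hF n (-t)).scomp t (hasDerivAt_neg t)).fun_const_smul ((-1 : ℝ) ^ n)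
    simpa using eq_zero_of_flat_of_nonneg (F := fun n t => (-1 : ℝ) ^ n • F n (-t)) hreflect hr
      hmono hdiv (by simp [h0]) (fun n t => by simpa [norm_smul] using hbound n (-t))
      (neg_nonneg.2 hx)

lemma eq_zero_of_flat_of_forall_eq_zero (hF : ∀ n t, HasDerivAt (F n) (F (n + 1) t) t)
    (h0 : ∀ n, F n 0 = 0) {N : ℕ} (hN : ∀ t, F N t = 0) (x : ℝ) : F 0 x = 0 := by
  induction N generalizing x with
  | zero => exact hN x
  | succ N ih =>
    refine ih (fun t => ?_) x
    rw [← h0 N]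
    exact is_const_of_deriv_eq_zero (fun y => (hF N y).differentiableAt)
      (fun y => (hF N y).deriv.trans (hN y)) t 0

variable {M : ℕ → ℝ}

lemma monotone_succ_div_of_sq_le_mul (hM : ∀ n, 0 < M n)
    (hconvex : ∀ n, M (n + 1) ^ 2 ≤ M n * M (n + 2)) : Monotone fun n => M (n + 1) / M n :=
  monotone_nat_of_le_succ fun n => by
    rw [div_le_div_iff₀ (hM n) (hM (n + 1)), ← sq, mul_comm]
    exact hconvex n

lemma prod_range_succ_div (hM : ∀ n, 0 < M n) (hM0 : M 0 = 1) (n : ℕ) :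
    ∏ i ∈ Finset.range n, M (i + 1) / M i = M n :=
  Finset.prod_range_induction _ M hM0 n fun i _ => (mul_div_cancel₀ _ (hM i).ne').symm

lemma not_summable_inv_succ_div (hM : ∀ n, 0 < M n) (hM0 : M 0 = 1)
    (hdiv : ∑' n : ℕ, ENNReal.ofReal (M (n + 1)) ^ (-(1 / ((n : ℝ) + 1))) = ∞) :
    ¬ Summable fun n => (M (n + 1) / M n)⁻¹ := fun hsum => by
  have hterm : ∀ n : ℕ, ENNReal.ofReal (M (n + 1)) ^ (-(1 / ((n : ℝ) + 1))) = ENNReal.ofReal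
      ((∏ i ∈ Finset.range (n + 1), (M (i + 1) / M i)⁻¹) ^ (1 / ((n : ℝ) + 1))) := fun n => by
    rw [Finset.prod_inv_distrib, prod_range_succ_div hM hM0,
      ENNReal.ofReal_rpow_of_pos (hM _), Real.rpow_neg (hM _).le, Real.inv_rpow (hM _).le]
  simp_rw [hterm] at hdiv
  exact (summable_geom_mean (fun n => inv_nonneg.2 (div_pos (hM _) (hM _)).le)
    hsum).tsum_ofReal_ne_top hdiv

theorem eq_zero_of_flat_of_sq_le_mul (hF : ∀ n t, HasDerivAt (F n) (F (n + 1) t) t)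
    (h0 : ∀ n, F n 0 = 0) (hM_nonneg : ∀ n, 0 ≤ M n) (hM0 : M 0 = 1)
    (hconvex : ∀ n, M (n + 1) ^ 2 ≤ M n * M (n + 2))
    (hdiv : ∑' n : ℕ, ENNReal.ofReal (M (n + 1)) ^ (-(1 / ((n : ℝ) + 1))) = ∞)
    (hbound : ∀ n t, ‖F n t‖ ≤ C * M n) (x : ℝ) : F 0 x = 0 := by
  by_cases hzero : ∃ N, M N = 0
  · obtain ⟨N, hN⟩ := hzero
    exact eq_zero_of_flat_of_forall_eq_zero hF h0
      (fun t => norm_le_zero_iff.1 (by simpa [hN] using hbound N t)) x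
  · have hM : ∀ n, 0 < M n := fun n =>
      (hM_nonneg n).lt_of_ne' fun h => hzero ⟨n, h⟩
    exact eq_zero_of_flat_of_norm_le_prod hF (fun n => div_pos (hM (n + 1)) (hM n))
      (monotone_succ_div_of_sq_le_mul hM hconvex) (not_summable_inv_succ_div hM hM0 hdiv) h0
      (fun n t => (prod_range_succ_div hM hM0 n).symm ▸ hbound n t) x

end DenjoyCarleman

section Determinacy

variable {μ ν : Measure ℝ}

lemma moment_id (k : ℕ) (μ : Measure ℝ) : moment id k μ = ∫ x, x ^ k ∂μ := rfl

lemma integral_abs_pow_two_mul (k : ℕ) (μ : Measure ℝ) :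
    ∫ x, |x| ^ (2 * k) ∂μ = moment id (2 * k) μ :=
  integral_congr_ae (ae_of_all _ fun x => (even_two_mul k).pow_abs x)

lemma HasFiniteMoments.memLp_id (h : HasFiniteMoments μ) (n : ℕ) : MemLp id n μ := by
  rcases eq_or_ne n 0 with rfl | hn
  · simpa using aestronglyMeasurable_id
  · rw [← integrable_norm_rpow_iff aestronglyMeasurable_id (by exact_mod_cast hn) (by simp)]
    simpa using h n

lemma HasFiniteMoments.sq_integral_abs_pow_succ_le (h : HasFiniteMoments μ) (n : ℕ) :
    (∫ x, |x| ^ (n + 1) ∂μ) ^ 2 ≤ (∫ x, |x| ^ n ∂μ) * ∫ x, |x| ^ (n + 2) ∂μ := by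
  set A := ∫ x, |x| ^ n ∂μ
  set B := ∫ x, |x| ^ (n + 1) ∂μ
  set D := ∫ x, |x| ^ (n + 2) ∂μ
  have hquad : ∀ t : ℝ, 0 ≤ A * (t * t) + 2 * B * t + D := fun t => by
    have heq : ∫ x, |x| ^ n * (t + |x|) ^ 2 ∂μ = A * (t * t) + 2 * B * t + D := by
      have hsplit : ∀ x : ℝ, |x| ^ n * (t + |x|) ^ 2 =
          t * t * |x| ^ n + 2 * t * |x| ^ (n + 1) + |x| ^ (n + 2) := fun x => by ring
      simp_rw [hsplit]
      have hA : Integrable (fun x => t * t * |x| ^ n) μ := (h n).const_mul _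
      have hB : Integrable (fun x => 2 * t * |x| ^ (n + 1)) μ := (h (n + 1)).const_mul _
      rw [integral_add (hA.fun_add hB) (h (n + 2)), integral_add hA hB, integral_const_mul,
        integral_const_mul]
      ring
    exact heq ▸ integral_nonneg fun x => by positivity
  have hdiscrim : (2 * B) ^ 2 - 4 * A * D ≤ 0 := discrim_le_zero hquad
  linarith

lemma HasFiniteMoments.hasDerivAt_iteratedDeriv_charFun [IsFiniteMeasure μ]
    (h : HasFiniteMoments μ) (n : ℕ) (t : ℝ) :
    HasDerivAt (iteratedDeriv n (charFun μ)) (iteratedDeriv (n + 1) (charFun μ) t) t := by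
  have hsmooth : ContDiff ℝ (n + 1 : ℕ) (charFun μ) := contDiff_charFun (h.memLp_id (n + 1))
  rw [iteratedDeriv_succ]
  exact (hsmooth.differentiable_iteratedDeriv n (by exact_mod_cast n.lt_succ_self) t).hasDerivAt

lemma HasFiniteMoments.norm_iteratedDeriv_charFun_le [IsFiniteMeasure μ]
    (h : HasFiniteMoments μ) (n : ℕ) (t : ℝ) :
    ‖iteratedDeriv n (charFun μ) t‖ ≤ ∫ x, |x| ^ n ∂μ := by
  rw [iteratedDeriv_charFun (h.memLp_id n), norm_mul, norm_pow, Complex.norm_I, one_pow, one_mul]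
  refine (norm_integral_le_integral_norm _).trans_eq (integral_congr_ae (ae_of_all _ fun x => ?_))
  have hexp : ‖Complex.exp (t * x * Complex.I)‖ = 1 := by
    exact_mod_cast Complex.norm_exp_ofReal_mul_I (t * x)
  simp [hexp]

/-- Carleman's condition in the Hamburger case: all moments `m_k` are finite and
`∑_{k ≥ 1} m_{2k} ^ (-1 / (2 k)) = ∞`, with the conventions of `StieltjesCarleman`. It is the
hypothesis of Carleman's theorem for distributions on the whole line. -/
def HamburgerCarleman (μ : Measure ℝ) : Prop :=
  HasFiniteMoments μ ∧
    ∑' k : ℕ, ENNReal.ofReal (moment id (2 * (k + 1)) μ) ^ (-(1 / (2 * ((k : ℝ) + 1)))) = ∞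

/-- The absolute moment of order `n` of the mixture `(ν + μ) / 2`, which dominates half the `n`-th
derivative of the difference of the two characteristic functions. -/
noncomputable def meanAbsMoment (ν μ : Measure ℝ) (n : ℕ) : ℝ :=
  (∫ x, |x| ^ n ∂(ν + μ)) / 2

lemma meanAbsMoment_sq_le (hν : HasFiniteMoments ν) (hμ : HasFiniteMoments μ) (n : ℕ) :
    meanAbsMoment ν μ (n + 1) ^ 2 ≤ meanAbsMoment ν μ n * meanAbsMoment ν μ (n + 2) := by
  have hadd : HasFiniteMoments (ν + μ) := fun n => (hν n).add_measure (hμ n)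
  have := hadd.sq_integral_abs_pow_succ_le n
  unfold meanAbsMoment
  linarith

lemma two_mul_meanAbsMoment (hν : HasFiniteMoments ν) (hμ : HasFiniteMoments μ) (n : ℕ) :
    2 * meanAbsMoment ν μ n = ∫ x, |x| ^ n ∂ν + ∫ x, |x| ^ n ∂μ := by
  rw [meanAbsMoment, integral_add_measure (hν n) (hμ n), mul_div_cancel₀ _ two_ne_zero]

lemma meanAbsMoment_two_mul (hν : HasFiniteMoments ν) (hμ : HasFiniteMoments μ) {k : ℕ}
    (hmoment : moment id (2 * k) ν = moment id (2 * k) μ) :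
    meanAbsMoment ν μ (2 * k) = moment id (2 * k) μ := by
  have := two_mul_meanAbsMoment hν hμ (2 * k)
  rw [integral_abs_pow_two_mul, integral_abs_pow_two_mul, hmoment] at this
  linarith

-- The odd terms, which Carleman's condition says nothing about, are simply dropped.
lemma HamburgerCarleman.tsum_meanAbsMoment_eq_top (hμ : HamburgerCarleman μ)
    (hν : HasFiniteMoments ν) (hmoment : ∀ k, moment id k ν = moment id k μ) :
    ∑' n : ℕ, ENNReal.ofReal (meanAbsMoment ν μ (n + 1)) ^ (-(1 / ((n : ℝ) + 1))) = ∞ := by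
  rw [eq_top_iff, ← hμ.2]
  refine le_of_eq_of_le (tsum_congr fun k => ?_) (ENNReal.tsum_comp_le_tsum_of_injective
    (f := fun k => 2 * k + 1) (fun _ _ h => by simpa using h) _)
  rw [add_assoc, ← mul_add_one, meanAbsMoment_two_mul hν hμ.1 (hmoment _)]
  push_cast
  ring_nf

theorem HamburgerCarleman.eq_of_moment_eq [IsProbabilityMeasure μ] [IsProbabilityMeasure ν]
    (hμ : HamburgerCarleman μ) (hν : HasFiniteMoments ν)
    (hmoment : ∀ k, moment id k ν = moment id k μ) : ν = μ := by
  have hderiv_zero : ∀ n, iteratedDeriv n (charFun ν) 0 = iteratedDeriv n (charFun μ) 0 := by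
    intro n
    rw [iteratedDeriv_charFun_zero (hν.memLp_id n), iteratedDeriv_charFun_zero (hμ.1.memLp_id n),
      ← moment_id, ← moment_id, hmoment]
  have hM0 : meanAbsMoment ν μ 0 = 1 := by
    simpa [moment_id] using meanAbsMoment_two_mul hν hμ.1 (hmoment (2 * 0))
  have hM_nonneg : ∀ n, 0 ≤ meanAbsMoment ν μ n := fun n =>
    div_nonneg (integral_nonneg fun x => by positivity) zero_le_two
  refine Measure.ext_of_charFun (funext fun t => sub_eq_zero.1 ?_)
  refine eq_zero_of_flat_of_sq_le_mul (C := 2)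
    (F := fun n t => iteratedDeriv n (charFun ν) t - iteratedDeriv n (charFun μ) t)
    (fun n t => (hν.hasDerivAt_iteratedDeriv_charFun n t).sub
      (hμ.1.hasDerivAt_iteratedDeriv_charFun n t))
    (fun n => sub_eq_zero.2 (hderiv_zero n))
    hM_nonneg hM0 (meanAbsMoment_sq_le hν hμ.1)
    (hμ.tsum_meanAbsMoment_eq_top hν hmoment) (fun n t => ?_) t
  rw [two_mul_meanAbsMoment hν hμ.1]
  exact (norm_sub_le _ _).trans (add_le_add (hν.norm_iteratedDeriv_charFun_le n t)
    (hμ.1.norm_iteratedDeriv_charFun_le n t))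

/-- The distribution of `± √X`, with a fair random sign independent of `X`, for `X` distributed as
`μ`. It turns the Stieltjes moment problem for `μ` into a symmetric Hamburger moment problem. -/
noncomputable def symmSqrt (μ : Measure ℝ) : Measure ℝ :=
  (2⁻¹ : ℝ≥0∞) • (μ.map Real.sqrt + μ.map fun x => -√x)

instance [IsProbabilityMeasure μ] : IsProbabilityMeasure (symmSqrt μ) := by
  have h₁ : IsProbabilityMeasure (μ.map Real.sqrt) :=
    Measure.isProbabilityMeasure_map (by fun_prop)
  have h₂ : IsProbabilityMeasure (μ.map fun x => -√x) :=
    Measure.isProbabilityMeasure_map (by fun_prop)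
  refine ⟨?_⟩
  simp [symmSqrt, ENNReal.inv_two_add_inv_two]

lemma map_sq_symmSqrt (hμ : ∀ᵐ x ∂μ, 0 ≤ x) : (symmSqrt μ).map (fun y => y ^ 2) = μ := by
  have hsq : (fun x => √x ^ 2) =ᵐ[μ] id := by
    filter_upwards [hμ] with x hx using Real.sq_sqrt hx
  rw [symmSqrt, Measure.map_smul, Measure.map_add _ _ (by fun_prop),
    Measure.map_map (by fun_prop) (by fun_prop), Measure.map_map (by fun_prop) (by fun_prop)]
  simp only [Function.comp_def, neg_sq]
  rw [Measure.map_congr hsq, Measure.map_id, ← two_smul ℝ≥0∞, smul_smul,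
    ENNReal.inv_mul_cancel two_ne_zero ENNReal.ofNat_ne_top, one_smul]

lemma HasFiniteMoments.integrable_sqrt_pow [IsFiniteMeasure μ] (h : HasFiniteMoments μ) (n : ℕ) :
    Integrable (fun x => √x ^ n) μ := by
  refine ((integrable_const (1 : ℝ)).add (h n)).mono' (by fun_prop) (ae_of_all _ fun x => ?_)
  rw [Real.norm_of_nonneg (by positivity)]
  rcases le_total x 1 with hx | hx
  · exact (pow_le_one₀ (Real.sqrt_nonneg x) (Real.sqrt_le_one.2 hx)).trans
      (le_add_of_nonneg_right (by positivity))
  · have hsqrt : √x ≤ |x| := (Real.sqrt_le_self_iff.2 (Or.inr hx)).trans (le_abs_self x)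
    exact (pow_le_pow_left₀ (Real.sqrt_nonneg x) hsqrt n).trans (le_add_of_nonneg_left zero_le_one)

lemma hasFiniteMoments_symmSqrt [IsFiniteMeasure μ] (h : HasFiniteMoments μ) :
    HasFiniteMoments (symmSqrt μ) := fun n => by
  have hcont : Continuous fun y : ℝ => |y| ^ n := by fun_prop
  refine (Integrable.add_measure ?_ ?_).smul_measure (by simp) <;>
  · rw [integrable_map_measure hcont.aestronglyMeasurable (by fun_prop)]
    simpa [Function.comp_def, abs_of_nonneg (Real.sqrt_nonneg _)] using h.integrable_sqrt_pow n

lemma HasFiniteMoments.moment_symmSqrt [IsFiniteMeasure μ] (h : HasFiniteMoments μ) (n : ℕ) :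
    moment id n (symmSqrt μ) = 2⁻¹ * (1 + (-1) ^ n) * ∫ x, √x ^ n ∂μ := by
  have hcont : Continuous fun y : ℝ => y ^ n := by fun_prop
  have hneg : ∀ x : ℝ, (-√x) ^ n = (-1) ^ n * √x ^ n := fun x => neg_pow _ n
  have hint : Integrable (fun x => (-√x) ^ n) μ := by
    simpa only [hneg] using (h.integrable_sqrt_pow n).const_mul _
  rw [moment_id, symmSqrt, integral_smul_measure, integral_add_measure
    ((integrable_map_measure hcont.aestronglyMeasurable (by fun_prop)).2 (h.integrable_sqrt_pow n))
    ((integrable_map_measure hcont.aestronglyMeasurable (by fun_prop)).2 hint),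
    integral_map (by fun_prop) hcont.aestronglyMeasurable,
    integral_map (by fun_prop) hcont.aestronglyMeasurable]
  simp_rw [hneg, integral_const_mul, ENNReal.toReal_inv, ENNReal.toReal_ofNat, smul_eq_mul]
  ring

lemma HasFiniteMoments.moment_two_mul_symmSqrt [IsFiniteMeasure μ] (h : HasFiniteMoments μ)
    (h0 : ∀ᵐ x ∂μ, 0 ≤ x) (k : ℕ) : moment id (2 * k) (symmSqrt μ) = moment id k μ := by
  have hsq : ∫ x, √x ^ (2 * k) ∂μ = ∫ x, x ^ k ∂μ := integral_congr_ae <| by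
    filter_upwards [h0] with x hx
    rw [pow_mul, Real.sq_sqrt hx]
  rw [h.moment_symmSqrt, (even_two_mul k).neg_one_pow, hsq, moment_id]
  ring

lemma HasFiniteMoments.moment_symmSqrt_of_odd [IsFiniteMeasure μ] (h : HasFiniteMoments μ)
    {n : ℕ} (hn : Odd n) : moment id n (symmSqrt μ) = 0 := by
  rw [h.moment_symmSqrt, hn.neg_one_pow]
  ring

lemma HasFiniteMoments.moment_symmSqrt_congr [IsFiniteMeasure μ] [IsFiniteMeasure ν]
    (hμ : HasFiniteMoments μ) (hν : HasFiniteMoments ν) (hμ0 : ∀ᵐ x ∂μ, 0 ≤ x)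
    (hν0 : ∀ᵐ x ∂ν, 0 ≤ x) (hmoment : ∀ k, moment id k ν = moment id k μ) (n : ℕ) :
    moment id n (symmSqrt ν) = moment id n (symmSqrt μ) := by
  rcases n.even_or_odd' with ⟨k, rfl | rfl⟩
  · rw [hν.moment_two_mul_symmSqrt hν0, hμ.moment_two_mul_symmSqrt hμ0, hmoment]
  · have hodd : Odd (2 * k + 1) := odd_two_mul_add_one k
    rw [hν.moment_symmSqrt_of_odd hodd, hμ.moment_symmSqrt_of_odd hodd]

lemma StieltjesCarleman.hamburgerCarleman_symmSqrt [IsFiniteMeasure μ] (hμ : StieltjesCarleman μ)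
    (h0 : ∀ᵐ x ∂μ, 0 ≤ x) : HamburgerCarleman (symmSqrt μ) := by
  refine ⟨hasFiniteMoments_symmSqrt hμ.1, ?_⟩
  simp_rw [hμ.1.moment_two_mul_symmSqrt h0]
  exact hμ.2

lemma measure_Iio_zero_eq_zero_iff : μ (Iio 0) = 0 ↔ ∀ᵐ x ∂μ, 0 ≤ x := by
  simp only [ae_iff, not_le, Iio_def]

theorem StieltjesCarleman.mDeterminate [IsProbabilityMeasure μ] (hμ : StieltjesCarleman μ)
    (h0 : μ (Iio 0) = 0) : StieltjesMDeterminate μ := by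
  refine ⟨inferInstance, h0, hμ.1, fun ν _ hν0 hν hmoment => ?_⟩
  have hμ_nonneg := measure_Iio_zero_eq_zero_iff.1 h0
  have hν_nonneg := measure_Iio_zero_eq_zero_iff.1 hν0
  have hmoment' : ∀ k, moment id k ν = moment id k μ := fun k => by
    rcases k.eq_zero_or_pos with rfl | hk
    · simp [moment_id]
    · exact hmoment k hk
  have hsymm : symmSqrt ν = symmSqrt μ :=
    (hμ.hamburgerCarleman_symmSqrt hμ_nonneg).eq_of_moment_eq (hasFiniteMoments_symmSqrt hν)
      (hμ.1.moment_symmSqrt_congr hν hμ_nonneg hν_nonneg hmoment')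
  rw [← map_sq_symmSqrt hν_nonneg, hsymm, map_sq_symmSqrt hμ_nonneg]

end Determinacy

section IntegralDivergence

lemma ofReal_integral_le_lintegral_ofReal {α : Type*} [MeasurableSpace α] (μ : Measure α)
    (f : α → ℝ) : ENNReal.ofReal (∫ x, f x ∂μ) ≤ ∫⁻ x, ENNReal.ofReal (f x) ∂μ := by
  by_cases hf : Integrable f μ
  · rw [integral_eq_lintegral_pos_part_sub_lintegral_neg_part hf]
    exact ENNReal.ofReal_le_of_le_toReal (sub_le_self _ ENNReal.toReal_nonneg)
  · simp [integral_undef hf]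

lemma lintegral_Ioi_eq_top_of_tendsto {f : ℝ → ℝ} {a : ℝ}
    (hf : Tendsto (fun R => ∫ x in a..R, f x) atTop atTop) :
    ∫⁻ x in Ioi a, ENNReal.ofReal (f x) = ∞ := by
  refine top_le_iff.1 (le_of_tendsto (ENNReal.tendsto_ofReal_atTop.comp hf) ?_)
  filter_upwards [eventually_ge_atTop a] with R hR
  rw [Function.comp_apply, intervalIntegral.integral_of_le hR]
  exact (ofReal_integral_le_lintegral_ofReal _ f).trans (lintegral_mono_set Ioc_subset_Ioi_self)

lemma lintegral_Ioi_inv_sq {b : ℝ} (hb : 0 < b) :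
    ∫⁻ x in Ioi b, ENNReal.ofReal (x ^ 2)⁻¹ = ENNReal.ofReal b⁻¹ := by
  have hrpow : EqOn (fun x : ℝ => x ^ (-2 : ℝ)) (fun x => (x ^ 2)⁻¹) (Ioi b) := fun x hx => by
    simp [Real.rpow_neg (hb.trans hx).le]
  have hint : IntegrableOn (fun x : ℝ => (x ^ 2)⁻¹) (Ioi b) :=
    (integrableOn_Ioi_rpow_of_lt (by norm_num) hb).congr_fun hrpow measurableSet_Ioi
  rw [← ofReal_integral_eq_lintegral_ofReal hint (ae_of_all _ fun x => by positivity),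
    ← setIntegral_congr_fun measurableSet_Ioi hrpow, integral_Ioi_rpow_of_lt (by norm_num) hb]
  norm_num [Real.rpow_neg_one]

end IntegralDivergence

section FirstPassage

/-- The first point of `[a, ∞)` at which `u` reaches the level `t`, up to attainment. For an
exponent `u`, it is the point from which on the density `x ^ (-u x)` is at most `x ^ (-t)`. -/
noncomputable def firstPassage (u : ℝ → ℝ) (a t : ℝ) : ℝ :=
  sInf {x | a ≤ x ∧ t ≤ u x}

variable {u : ℝ → ℝ} {a t x : ℝ}

lemma firstPassage_le (hx : a ≤ x) (ht : t ≤ u x) : firstPassage u a t ≤ x :=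
  csInf_le ⟨a, fun _ h => h.1⟩ ⟨hx, ht⟩

lemma exists_ge_and_le_of_tendsto_atTop (hu : Tendsto u atTop atTop) (a t : ℝ) :
    ∃ x, a ≤ x ∧ t ≤ u x :=
  ((eventually_ge_atTop a).and (hu.eventually_ge_atTop t)).exists

lemma le_firstPassage (hu : Tendsto u atTop atTop) : a ≤ firstPassage u a t :=
  le_csInf (exists_ge_and_le_of_tendsto_atTop hu a t) fun _ h => h.1

lemma le_of_firstPassage_lt (hu : Tendsto u atTop atTop) (hmono : MonotoneOn u (Ici a))
    (hx : firstPassage u a t < x) : t ≤ u x := by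
  obtain ⟨y, ⟨hay, hty⟩, hyx⟩ := exists_lt_of_csInf_lt (exists_ge_and_le_of_tendsto_atTop hu a t) hx
  exact hty.trans (hmono hay (hay.trans hyx.le) hyx.le)

lemma ofReal_le_add_tsum_indicator_firstPassage (s : ℝ) (hx : a ≤ x) :
    ENNReal.ofReal (u x) ≤
      ENNReal.ofReal s + ∑' k : ℕ, (Ici (firstPassage u a (k + s))).indicator 1 x := by
  set N := ⌈u x - s⌉₊
  have hpassed : ∀ k ∈ Finset.range N, (Ici (firstPassage u a (k + s))).indicator 1 x =
      (1 : ℝ≥0∞) := fun k hk => by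
    have hk' : (k : ℝ) < u x - s := Nat.lt_ceil.1 (Finset.mem_range.1 hk)
    exact indicator_of_mem (firstPassage_le hx (by linarith)) _
  calc ENNReal.ofReal (u x) ≤ ENNReal.ofReal (s + N) :=
        ENNReal.ofReal_le_ofReal (by linarith [Nat.le_ceil (u x - s)])
    _ ≤ ENNReal.ofReal s + N := ENNReal.ofReal_add_le.trans_eq (by rw [ENNReal.ofReal_natCast])
    _ = ENNReal.ofReal s +
        ∑ k ∈ Finset.range N, (Ici (firstPassage u a (k + s))).indicator 1 x := by
      rw [Finset.sum_congr rfl hpassed, Finset.sum_const, Finset.card_range, nsmul_one]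
    _ ≤ _ := add_le_add_right (ENNReal.sum_le_tsum _) _

lemma lintegral_Ioi_indicator_Ici_mul_inv_sq_le {c : ℝ} (hc : 0 < c) (ha : 0 ≤ a) :
    ∫⁻ x in Ioi a, (Ici c).indicator 1 (x ^ 2) * ENNReal.ofReal (x ^ 2)⁻¹ ≤
      ENNReal.ofReal (√c)⁻¹ :=
  calc ∫⁻ x in Ioi a, (Ici c).indicator 1 (x ^ 2) * ENNReal.ofReal (x ^ 2)⁻¹
      = ∫⁻ x in Ioi a, (Ici √c).indicator (fun x => ENNReal.ofReal (x ^ 2)⁻¹) x :=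
        setLIntegral_congr_fun measurableSet_Ioi fun x hx => by
          simp only [indicator, mem_Ici, Real.sqrt_le_left (ha.trans hx.le), Pi.one_apply,
            ite_mul, one_mul, zero_mul]
    _ ≤ ∫⁻ x in Ici √c, ENNReal.ofReal (x ^ 2)⁻¹ := by
        rw [← lintegral_indicator measurableSet_Ici]
        exact setLIntegral_le_lintegral _ _
    _ = ENNReal.ofReal (√c)⁻¹ := by
        rw [← restrict_Ioi_eq_restrict_Ici, lintegral_Ioi_inv_sq (Real.sqrt_pos.2 hc)]

lemma lintegral_Ioi_mul_inv_sq_le_tsum_firstPassage (ha : 1 ≤ a) (hu : Tendsto u atTop atTop)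
    (s : ℝ) :
    ∫⁻ x in Ioi a, ENNReal.ofReal (u (x ^ 2) * (x ^ 2)⁻¹) ≤
      ENNReal.ofReal s * ENNReal.ofReal a⁻¹ +
        ∑' k : ℕ, ENNReal.ofReal (√(firstPassage u a (k + s)))⁻¹ := by
  have ha0 : 0 < a := one_pos.trans_le ha
  have hmeas : ∀ k : ℕ, Measurable fun x : ℝ =>
      (Ici (firstPassage u a (k + s))).indicator (1 : ℝ → ℝ≥0∞) (x ^ 2) *
        ENNReal.ofReal (x ^ 2)⁻¹ := fun k =>
    ((measurable_one.indicator measurableSet_Ici).comp (by fun_prop)).mul (by fun_prop)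
  calc ∫⁻ x in Ioi a, ENNReal.ofReal (u (x ^ 2) * (x ^ 2)⁻¹)
      ≤ ∫⁻ x in Ioi a, (ENNReal.ofReal s * ENNReal.ofReal (x ^ 2)⁻¹ + ∑' k : ℕ,
          (Ici (firstPassage u a (k + s))).indicator 1 (x ^ 2) * ENNReal.ofReal (x ^ 2)⁻¹) := by
        refine setLIntegral_mono' measurableSet_Ioi fun x (hx : a < x) => ?_
        rw [ENNReal.ofReal_mul' (by positivity), ENNReal.tsum_mul_right, ← add_mul]
        gcongr
        exact ofReal_le_add_tsum_indicator_firstPassage s (by nlinarith)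
    _ = ENNReal.ofReal s * ENNReal.ofReal a⁻¹ + ∑' k : ℕ, ∫⁻ x in Ioi a,
          (Ici (firstPassage u a (k + s))).indicator 1 (x ^ 2) * ENNReal.ofReal (x ^ 2)⁻¹ := by
        rw [lintegral_add_left (by fun_prop), lintegral_const_mul _ (by fun_prop),
          lintegral_Ioi_inv_sq ha0, lintegral_tsum fun k => (hmeas k).aemeasurable]
    _ ≤ _ := by
        gcongr with k
        exact lintegral_Ioi_indicator_Ici_mul_inv_sq_le (ha0.trans_le (le_firstPassage hu)) ha0.le

lemma tsum_inv_sqrt_firstPassage_eq_top (ha : 1 ≤ a) (hu : Tendsto u atTop atTop)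
    (hdiv : ∫⁻ x in Ioi a, ENNReal.ofReal (u (x ^ 2) * (x ^ 2)⁻¹) = ∞) (s : ℝ) :
    ∑' k : ℕ, ENNReal.ofReal (√(firstPassage u a (k + s)))⁻¹ = ∞ := by
  have hle := lintegral_Ioi_mul_inv_sq_le_tsum_firstPassage ha hu s
  rw [hdiv, top_le_iff, ENNReal.add_eq_top] at hle
  exact hle.resolve_left (ENNReal.mul_ne_top ENNReal.ofReal_ne_top ENNReal.ofReal_ne_top)

end FirstPassage

section MomentGrowth

variable {μ : Measure ℝ}

lemma restrict_le_withDensity_restrict {s t : Set ℝ} {f : ℝ → ℝ≥0∞} (hs : MeasurableSet s)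
    (hst : s ⊆ t) (h : μ.restrict t ≤ (volume.restrict t).withDensity f) :
    μ.restrict s ≤ (volume.restrict s).withDensity f := by
  rw [← Measure.restrict_restrict_of_subset (μ := μ) hst,
    ← Measure.restrict_restrict_of_subset (μ := volume) hst, ← restrict_withDensity hs]
  exact Measure.restrict_mono_measure h _

lemma lintegral_Ioi_abs_pow_le {n : ℕ} {c : ℝ} (hc : 0 < c)
    (hμ : μ.restrict (Ioi c) ≤
      (volume.restrict (Ioi c)).withDensity fun x => ENNReal.ofReal (x ^ (n + 2))⁻¹) :
    ∫⁻ x in Ioi c, ENNReal.ofReal (|x| ^ n) ∂μ ≤ ENNReal.ofReal c⁻¹ := by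
  calc ∫⁻ x in Ioi c, ENNReal.ofReal (|x| ^ n) ∂μ
      ≤ ∫⁻ x in Ioi c, ENNReal.ofReal (x ^ (n + 2))⁻¹ * ENNReal.ofReal (|x| ^ n) :=
        (lintegral_mono' hμ le_rfl).trans_eq
          (lintegral_withDensity_eq_lintegral_mul _ (by fun_prop) (by fun_prop))
    _ = ∫⁻ x in Ioi c, ENNReal.ofReal (x ^ 2)⁻¹ :=
        setLIntegral_congr_fun measurableSet_Ioi fun x hx => by
          have hx0 : 0 < x := hc.trans hx
          simp only [abs_of_pos hx0]
          rw [← ENNReal.ofReal_mul (by positivity)]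
          congr 1
          field_simp
          ring
    _ = ENNReal.ofReal c⁻¹ := lintegral_Ioi_inv_sq hc

lemma lintegral_abs_pow_le [IsProbabilityMeasure μ] (h0 : ∀ᵐ x ∂μ, 0 ≤ x) {n : ℕ} {c : ℝ}
    (hc : 1 ≤ c)
    (hμ : μ.restrict (Ioi c) ≤
      (volume.restrict (Ioi c)).withDensity fun x => ENNReal.ofReal (x ^ (n + 2))⁻¹) :
    ∫⁻ x, ENNReal.ofReal (|x| ^ n) ∂μ ≤ ENNReal.ofReal (c ^ n + 1) := by
  have hc0 : 0 < c := one_pos.trans_le hc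
  have hhead : ∫⁻ x in Iic c, ENNReal.ofReal (|x| ^ n) ∂μ ≤ ENNReal.ofReal (c ^ n) :=
    calc ∫⁻ x in Iic c, ENNReal.ofReal (|x| ^ n) ∂μ
        ≤ ∫⁻ _ in Iic c, ENNReal.ofReal (c ^ n) ∂μ := by
          refine setLIntegral_mono_ae' measurableSet_Iic ?_
          filter_upwards [h0] with x hx (hxc : x ≤ c)
          rw [abs_of_nonneg hx]
          gcongr
      _ ≤ ENNReal.ofReal (c ^ n) := by
          rw [setLIntegral_const]
          exact mul_le_of_le_one_right' prob_le_one
  rw [← lintegral_add_compl _ (measurableSet_Iic (a := c)), compl_Iic,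
    ENNReal.ofReal_add (by positivity) zero_le_one]
  exact add_le_add hhead ((lintegral_Ioi_abs_pow_le hc0 hμ).trans
    (ENNReal.ofReal_le_ofReal (inv_le_one_of_one_le₀ hc)))

lemma StieltjesCarleman.of_lintegral_abs_pow_le [IsFiniteMeasure μ] {R : ℕ → ℝ}
    (hR : ∀ k, 0 < R k)
    (hle : ∀ k, ∫⁻ x, ENNReal.ofReal (|x| ^ (k + 1)) ∂μ ≤ ENNReal.ofReal (R k ^ (k + 1)))
    (hdiv : ∑' k, ENNReal.ofReal (√(R k))⁻¹ = ∞) : StieltjesCarleman μ := by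
  have hfinite : HasFiniteMoments μ
    | 0 => by simp
    | k + 1 => (lintegral_ofReal_ne_top_iff_integrable (by fun_prop)
        (ae_of_all _ fun x => by positivity)).1 (ne_top_of_le_ne_top ENNReal.ofReal_ne_top (hle k))
  refine ⟨hfinite, top_le_iff.1 (hdiv.symm.trans_le (ENNReal.tsum_le_tsum fun k => ?_))⟩
  have hmoment : ENNReal.ofReal (moment id (k + 1) μ) ≤ ENNReal.ofReal (R k ^ (k + 1)) :=
    (ofReal_integral_le_lintegral_ofReal μ fun x => x ^ (k + 1)).trans <|
      (lintegral_mono fun x => ENNReal.ofReal_le_ofReal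
        ((le_abs_self _).trans_eq (abs_pow x _))).trans (hle k)
  have hroot : (√(R k))⁻¹ = (R k ^ (k + 1)) ^ (-(1 / (2 * ((k : ℝ) + 1)))) := by
    rw [← Real.rpow_natCast, ← Real.rpow_mul (hR k).le, Real.sqrt_eq_rpow,
      ← Real.rpow_neg (hR k).le]
    congr 1
    push_cast
    field_simp
  rw [hroot, ← ENNReal.ofReal_rpow_of_pos (pow_pos (hR k) _), ENNReal.rpow_neg, ENNReal.rpow_neg]
  exact ENNReal.inv_le_inv.2 (ENNReal.rpow_le_rpow hmoment (by positivity))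

variable {u : ℝ → ℝ} {a : ℝ}

lemma restrict_Ioi_firstPassage_le_withDensity (ha : 1 ≤ a) (hmono : MonotoneOn u (Ici a))
    (hu : Tendsto u atTop atTop)
    (hμ : μ.restrict (Ici a) ≤
      (volume.restrict (Ici a)).withDensity fun x => ENNReal.ofReal (x ^ (-u x))) (n : ℕ) :
    μ.restrict (Ioi (firstPassage u a n)) ≤
      (volume.restrict (Ioi (firstPassage u a n))).withDensity
        fun x => ENNReal.ofReal (x ^ n)⁻¹ := by
  have hsubset : Ioi (firstPassage u a n) ⊆ Ici a := fun x hx => (le_firstPassage hu).trans hx.le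
  refine (restrict_le_withDensity_restrict measurableSet_Ioi hsubset hμ).trans
    (withDensity_mono (ae_restrict_of_forall_mem measurableSet_Ioi fun x hx =>
      ENNReal.ofReal_le_ofReal ?_))
  have hx1 : 1 ≤ x := ha.trans (hsubset hx)
  rw [← Real.rpow_natCast, ← Real.rpow_neg (zero_le_one.trans hx1)]
  exact Real.rpow_le_rpow_of_exponent_le hx1 (neg_le_neg (le_of_firstPassage_lt hu hmono hx))

theorem stieltjesCarleman_of_le_withDensity_rpow [IsProbabilityMeasure μ]
    (h0 : ∀ᵐ x ∂μ, 0 ≤ x) (ha : 1 ≤ a) (hmono : MonotoneOn u (Ici a))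
    (hu : Tendsto u atTop atTop)
    (hμ : μ.restrict (Ici a) ≤
      (volume.restrict (Ici a)).withDensity fun x => ENNReal.ofReal (x ^ (-u x)))
    (hdiv : ∫⁻ x in Ioi a, ENNReal.ofReal (u (x ^ 2) * (x ^ 2)⁻¹) = ∞) :
    StieltjesCarleman μ := by
  set c : ℕ → ℝ := fun k => firstPassage u a (k + 3)
  have hc : ∀ k, 1 ≤ c k := fun k => ha.trans (le_firstPassage hu)
  have hmoment : ∀ k, ∫⁻ x, ENNReal.ofReal (|x| ^ (k + 1)) ∂μ ≤
      ENNReal.ofReal ((2 * c k) ^ (k + 1)) := fun k => by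
    have htail := restrict_Ioi_firstPassage_le_withDensity ha hmono hu hμ (k + 3)
    push_cast at htail
    refine (lintegral_abs_pow_le h0 (hc k) htail).trans (ENNReal.ofReal_le_ofReal ?_)
    calc c k ^ (k + 1) + 1 ≤ 2 * c k ^ (k + 1) := by linarith [one_le_pow₀ (hc k) (n := k + 1)]
      _ ≤ 2 ^ (k + 1) * c k ^ (k + 1) := by
          have := one_le_pow₀ (hc k) (n := k + 1)
          gcongr
          exact le_self_pow₀ one_le_two k.succ_ne_zero
      _ = (2 * c k) ^ (k + 1) := (mul_pow _ _ _).symm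
  refine StieltjesCarleman.of_lintegral_abs_pow_le
    (fun k => mul_pos two_pos (one_pos.trans_le (hc k))) hmoment ?_
  simp_rw [Real.sqrt_mul zero_le_two, mul_inv,
    ENNReal.ofReal_mul (inv_nonneg.2 (Real.sqrt_nonneg 2))]
  rw [ENNReal.tsum_mul_left, tsum_inv_sqrt_firstPassage_eq_top ha hu hdiv]
  exact ENNReal.mul_top (ENNReal.ofReal_pos.2 (by positivity)).ne'

end MomentGrowth

lemma rpow_neg_neg_log_div_log {x y : ℝ} (hx : 1 < x) (hy : 0 < y) :
    x ^ (-(-Real.log y / Real.log x)) = y := by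
  rw [neg_div, neg_neg, Real.log_div_log, Real.rpow_logb (by linarith) hx.ne' hy]

theorem theorem2_general {μ : Measure ℝ} [IsProbabilityMeasure μ] (h0 : ∀ᵐ x ∂μ, 0 ≤ x)
    {g : ℝ → ℝ} {a : ℝ} (ha : 1 < a)
    (hg : μ.restrict (Ici a) ≤
      (volume.restrict (Ici a)).withDensity fun x => ENNReal.ofReal (g x))
    (hg_pos : ∀ x ∈ Ici a, 0 < g x)
    (hK : Tendsto (fun R : ℝ => ∫ x in a..R, -Real.log (g (x ^ 2)) / (x ^ 2 * Real.log x))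
      atTop atTop)
    (hu_mono : MonotoneOn (fun x : ℝ => -Real.log (g x) / Real.log x) (Ici a))
    (hu_lim : Tendsto (fun x : ℝ => -Real.log (g x) / Real.log x) atTop atTop) :
    StieltjesCarleman μ ∧ StieltjesMDeterminate μ := by
  have hdensity : μ.restrict (Ici a) ≤ (volume.restrict (Ici a)).withDensity
      fun x => ENNReal.ofReal (x ^ (-(-Real.log (g x) / Real.log x))) :=
    hg.trans_eq (withDensity_congr_ae (ae_restrict_of_forall_mem measurableSet_Ici fun x hx => by
      simp only
      rw [rpow_neg_neg_log_div_log (ha.trans_le hx) (hg_pos x hx)]))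
  have hdiv : ∫⁻ x in Ioi a, ENNReal.ofReal
      (-Real.log (g (x ^ 2)) / Real.log (x ^ 2) * (x ^ 2)⁻¹) = ∞ := by
    refine lintegral_Ioi_eq_top_of_tendsto ((hK.const_mul_atTop (one_half_pos (α := ℝ))).congr
      fun R => ?_)
    rw [← intervalIntegral.integral_const_mul]
    congr 1 with x
    rw [Real.log_pow]
    push_cast
    ring
  have hcarleman := stieltjesCarleman_of_le_withDensity_rpow h0 ha.le hu_mono hu_lim hdensity hdiv
  exact ⟨hcarleman, hcarleman.mDeterminate (measure_Iio_zero_eq_zero_iff.2 h0)⟩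

theorem theorem2 {Ω : Type*} [MeasurableSpace Ω] (P : Measure Ω) [IsProbabilityMeasure P]
    (Y : Ω → ℝ) (hY : AEMeasurable Y P) (hY_nonneg : ∀ᵐ ω ∂P, 0 ≤ Y ω)
    (hY_moments : HasFiniteMoments (P.map Y))
    (g : ℝ → ℝ) (hg_meas : Measurable g) (hg_nonneg : ∀ x, 0 ≤ g x)
    (hg_density : P.map Y = volume.withDensity (fun x => ENNReal.ofReal (g x)))
    (a : ℝ) (ha : 1 < a)
    (hg_cont : ContinuousOn g (Ici a)) (hg_pos : ∀ x ∈ Ici a, 0 < g x)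
    (hK : Tendsto (fun R : ℝ => ∫ x in a..R, -Real.log (g (x ^ 2)) / (x ^ 2 * Real.log x))
      atTop atTop)
    (hu_mono : MonotoneOn (fun x : ℝ => -Real.log (g x) / Real.log x) (Ici a))
    (hu_lim : Tendsto (fun x : ℝ => -Real.log (g x) / Real.log x) atTop atTop) :
    StieltjesCarleman (P.map Y) ∧ StieltjesMDeterminate (P.map Y) := by
  have := Measure.isProbabilityMeasure_map hY
  exact theorem2_general ((ae_map_iff hY measurableSet_Ici).2 hY_nonneg) ha
    (hg_density ▸ (restrict_withDensity measurableSet_Ici _).le) hg_pos hK hu_mono hu_lim
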